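/- Let $0\le k\le n$ and $r\ge 1$ be integers, let $T\subset\mathbb{R}^n$ be a (nondegenerate, closed) $n$-simplex, and let $e$ be a real function that is integrable on $T$ and satisfies $e(x)>0$ for all $x\in T$. For an integer $s$, let $\mathcal{P}_s\Lambda^k(T)$ denote the space of differential $k$-forms with polynomial coefficients of degree at most $s$, and $\mathcal{H}_s\Lambda^k(T)$ the space of those with homogeneous polynomial coefficients of degree $s$ (both are $\{0\}$ if $s<0$). Put $$\mathcal{P}^-_s\Lambda^k(T)=\mathcal{P}_{s-1}\Lambda^k(T)+\kappa\,\mathcal{H}_{s-1}\Lambda^{k+1}(T),\qquad (\kappa\mu)_x(v_1,\dots,v_k)=\mu_x(x,v_1,\dots,v_k),$$ which is $\{0\}$ if $s\le 0$, and let $\mathring{\mathcal{P}}_s\Lambda^k(T)$ be the space of all $\omega\in\mathcal{P}_s\Lambda^k(T)$ whose trace (pullback under the inclusion) on every proper subsimplex of $T$ vanishes. If $\omega\in\mathring{\mathcal{P}}_r\Lambda^k(T)$ satisfies $$\int_T e\,\omega\wedge\eta=0\qquad\text{for all }\eta\in\mathcal{P}^-_{r-n+k}\Lambda^{n-k}(T),$$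 then $\omega=0$. -/

import Mathlib

open MeasureTheory

namespace QuasiForms

/-- Euclidean space `ℝⁿ`. -/
abbrev E (n : ℕ) : Type := EuclideanSpace ℝ (Fin n)

/-- Differential `k`-forms on `ℝⁿ` (no regularity imposed): functions `ℝⁿ → Alt^k ℝⁿ`. -/
abbrev Form (n k : ℕ) : Type := E n → (E n) [⋀^Fin k]→ₗ[ℝ] ℝ

/-- Real functions on `ℝⁿ` given by a polynomial all of whose monomials have a total degree
satisfying `D`. -/
def polyFun (n : ℕ) (D : ℕ → Prop) : Submodule ℝ (E n → ℝ) where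
  carrier := {f | ∃ p : MvPolynomial (Fin n) ℝ, (∀ m ∈ p.support, D m.degree) ∧
    ∀ x : E n, f x = MvPolynomial.eval (fun i => x i) p}
  zero_mem' := ⟨0, by simp, by simp⟩
  add_mem' := by
    rintro f g ⟨p, hp, hpf⟩ ⟨q, hq, hqg⟩
    refine ⟨p + q, fun m hm => ?_, fun x => by simp [hpf, hqg]⟩
    rcases Finset.mem_union.1 (MvPolynomial.support_add hm) with h | h
    · exact hp m h
    · exact hq m h
  smul_mem' := by
    rintro c f ⟨p, hp, hpf⟩
    exact ⟨c • p, fun m hm => hp m (MvPolynomial.support_smul hm),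
      fun x => by simp [hpf, MvPolynomial.smul_eval]⟩

/-- Forms with coefficients in a space `S` of functions: for all fixed vectors `v₁, …, v_k`
the function `x ↦ ω_x(v₁, …, v_k)` lies in `S`. -/
def formsWithCoeffs {n : ℕ} (k : ℕ) (S : Submodule ℝ (E n → ℝ)) : Submodule ℝ (Form n k) where
  carrier := {ω | ∀ v : Fin k → E n, (fun x => ω x v) ∈ S}
  zero_mem' := fun _ => S.zero_mem
  add_mem' := fun hω hη v => S.add_mem (hω v) (hη v)
  smul_mem' := fun c _ hω v => S.smul_mem c (hω v)

/-- `𝒫_s Λ^k`: polynomial `k`-forms of degree at most `s` (only `0` if `s < 0`). -/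
def PForm (n : ℕ) (s : ℤ) (k : ℕ) : Submodule ℝ (Form n k) :=
  formsWithCoeffs k (polyFun n fun d => (d : ℤ) ≤ s)

/-- `ℋ_s Λ^k`: homogeneous polynomial `k`-forms of degree `s` (only `0` if `s < 0`). -/
def HForm (n : ℕ) (s : ℤ) (k : ℕ) : Submodule ℝ (Form n k) :=
  formsWithCoeffs k (polyFun n fun d => (d : ℤ) = s)

/-- The Koszul operator `(κω)_x(v₁, …, v_k) = ω_x(x, v₁, …, v_k)`. -/
def koszul (n k : ℕ) : Form n (k + 1) →ₗ[ℝ] Form n k where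
  toFun ω := fun x => (ω x).curryLeft x
  map_add' _ _ := rfl
  map_smul' _ _ := rfl

/-- `𝒫_s^- Λ^k = 𝒫_{s-1} Λ^k + κ ℋ_{s-1} Λ^{k+1}` (only `0` if `s ≤ 0`). -/
def PMinusForm (n : ℕ) (s : ℤ) (k : ℕ) : Submodule ℝ (Form n k) :=
  PForm n (s - 1) k ⊔ (HForm n (s - 1) (k + 1)).map (koszul n k)

/-- The trace on a set `F` (a subsimplex) of a form at a point: the restriction of the
alternating form to vectors tangent to `F`. -/
noncomputable def traceAt {n k : ℕ} (F : Set (E n)) (a : (E n) [⋀^Fin k]→ₗ[ℝ] ℝ) :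
    (vectorSpan ℝ F) [⋀^Fin k]→ₗ[ℝ] ℝ :=
  a.compLinearMap (vectorSpan ℝ F).subtype

/-- The subsimplex of `T` spanned by the vertices with index in `s`. -/
def subsimplex {n : ℕ} (T : Affine.Simplex ℝ (E n) n) (s : Finset (Fin (n + 1))) :
    Set (E n) :=
  convexHull ℝ (T.points '' (s : Set (Fin (n + 1))))

/-- The closed simplex `T` as a set. -/
def body {n : ℕ} (T : Affine.Simplex ℝ (E n) n) : Set (E n) :=
  subsimplex T Finset.univ

/-- `𝒫̊_s Λ^k(T)`: forms in `𝒫_s Λ^k` whose traces on all proper subsimplices of `T` (that is,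
on the boundary of `T`) vanish. -/
def PRingForm {n : ℕ} (T : Affine.Simplex ℝ (E n) n) (s : ℤ) (k : ℕ) :
    Submodule ℝ (Form n k) where
  carrier := {ω | ω ∈ PForm n s k ∧ ∀ f : Finset (Fin (n + 1)), f ≠ Finset.univ →
    ∀ x ∈ subsimplex T f, traceAt (subsimplex T f) (ω x) = 0}
  zero_mem' := ⟨Submodule.zero_mem _, fun _ _ _ _ => rfl⟩
  add_mem' := by
    rintro ω η ⟨h1, h2⟩ ⟨h3, h4⟩
    refine ⟨Submodule.add_mem _ h1 h3, fun f hf x hx => ?_⟩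
    change traceAt _ (ω x) + traceAt _ (η x) = 0
    rw [h2 f hf x hx, h4 f hf x hx, add_zero]
  smul_mem' := by
    rintro c ω ⟨h1, h2⟩
    refine ⟨Submodule.smul_mem _ c h1, fun f hf x hx => ?_⟩
    change c • traceAt _ (ω x) = 0
    rw [h2 f hf x hx, smul_zero]

/-- The wedge product of alternating forms (signed sum over shuffles). -/
noncomputable def wedge {V : Type*} [AddCommGroup V] [Module ℝ V] {k l : ℕ}
    (a : V [⋀^Fin k]→ₗ[ℝ] ℝ) (b : V [⋀^Fin l]→ₗ[ℝ] ℝ) : V [⋀^Fin (k + l)]→ₗ[ℝ] ℝ :=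
  ((LinearMap.mul' ℝ ℝ).compAlternatingMap (a.domCoprod b)).domDomCongr finSumFinEquiv

/-- The coefficient of an alternating form of top degree `m = n` with respect to the standard
volume form of `ℝⁿ`: its value on the standard basis. -/
noncomputable def topCoeff {n m : ℕ} (h : m = n) (a : (E n) [⋀^Fin m]→ₗ[ℝ] ℝ) : ℝ :=
  a fun i => EuclideanSpace.basisFun (Fin n) ℝ (Fin.cast h i)

/-- The integral over `T` of a differential form of top degree `m = n`. -/
noncomputable def integralForm {n m : ℕ} (h : m = n) (T : Affine.Simplex ℝ (E n) n)
    (ω : Form n m) : ℝ :=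
  ∫ x in body T, topCoeff h (ω x)

end QuasiForms

namespace QuasiForms

/-! ### Polynomial forms and degree bounds by integers -/

open MvPolynomial (X C)

/-! The moments are tested on one explicit form η built from ω. Put l = n - k, let v_i be the
vertices of T, λ_i the barycentric coordinates and b = ∏ λ_i the bubble. The dual form is B_x = Σ_I
λ_I(x) ω_x(v_I) vol(v_I - x, ·), summed over k-tuples I of vertices, where λ_I is the product of the
λ_i over I, and v_I - x lists the vectors v_i - x.

Positivity: since Σ λ_i (v_i - x) = 0, the factor ω_x(v_I) may be replaced by ω_x(v_I - x), so that
ω ∧ B = Σ_I λ_I ω(v_I - x)² vol (`topCoeff_wedge_dualAt`).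

Divisibility: on the facet λ_i = 0, a tuple containing i has λ_I = 0, and for any other tuple the
vectors v_I - x are tangent to the facet, where ω has zero trace. So B vanishes there
(`dualAt_eq_zero_of_mem_facet`), b divides B, and η = B / b is polynomial.

Degree: by alternation both B and κB have degree at most r + k + 1, hence η and κη have degree at
most r - l. The top homogeneous part of η is therefore killed by κ, hence in the range of κ by the
Koszul homotopy formula, which puts η in 𝒫⁻_{r-l}Λ^l (`exists_mem_PMinusForm_smul_eq_dualAt`).

Now ∫ e ω ∧ η = 0 has a nonnegative integrand, so every square vanishes inside T. The vectors v_i -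
x span ℝⁿ, so ω = 0. -/

theorem alternatingMap_sum_apply {R V N ι κ : Type*} [CommSemiring R] [AddCommMonoid V]
    [Module R V] [AddCommMonoid N] [Module R N] (t : Finset κ) (f : κ → V [⋀^ι]→ₗ[R] N)
    (u : ι → V) : (∑ i ∈ t, f i) u = ∑ i ∈ t, f i u := by
  classical
  induction t using Finset.induction_on with
  | empty => simp
  | insert a t ha ih => simp [Finset.sum_insert ha, ih]

/-- Alternating forms on `ℝⁿ` with polynomial values. -/
abbrev PolyAlt (n k : ℕ) : Type := (E n) [⋀^Fin k]→ₗ[ℝ] MvPolynomial (Fin n) ℝ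

/-- Evaluation of polynomials at a point of `ℝⁿ`. -/
noncomputable def evalAt {n : ℕ} (x : E n) : MvPolynomial (Fin n) ℝ →ₗ[ℝ] ℝ :=
  (MvPolynomial.aeval (fun i => x i)).toLinearMap

theorem evalAt_apply {n : ℕ} (x : E n) (p : MvPolynomial (Fin n) ℝ) :
    evalAt x p = MvPolynomial.eval (fun i => x i) p := by
  simp [evalAt, MvPolynomial.aeval_eq_eval]

theorem eq_of_evalAt_eq {n : ℕ} {p q : MvPolynomial (Fin n) ℝ}
    (h : ∀ x : E n, evalAt x p = evalAt x q) : p = q := by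
  refine MvPolynomial.funext fun y => ?_
  simpa [evalAt_apply] using h (WithLp.toLp 2 y)

/-- The differential form with the given polynomial coefficients. -/
noncomputable def evalForm {n k : ℕ} (Q : PolyAlt n k) : Form n k :=
  fun x => (evalAt x).compAlternatingMap Q

theorem evalForm_apply {n k : ℕ} (Q : PolyAlt n k) (x : E n) (v : Fin k → E n) :
    evalForm Q x v = evalAt x (Q v) := rfl

/-- A real polynomial is determined by its values, so coefficient polynomials chosen separately for
each v automatically inherit multilinearity and alternation. -/
theorem exists_evalForm_eq {n k : ℕ} {D : ℕ → Prop} {ω : Form n k}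
    (hω : ω ∈ formsWithCoeffs k (polyFun n D)) :
    ∃ Q : PolyAlt n k, evalForm Q = ω ∧ ∀ v, ∀ m ∈ (Q v).support, D m.degree := by
  choose p hp hpω using hω
  have key : ∀ v x, evalAt x (p v) = ω x v := fun v x => by rw [evalAt_apply]; exact (hpω v x).symm
  refine ⟨{ toFun := p, map_update_add' := ?_, map_update_smul' := ?_,
            map_eq_zero_of_eq' := ?_ }, ?_, hp⟩
  · intro _ v i a b
    refine eq_of_evalAt_eq fun x => ?_
    rw [map_add, key, key, key]
    exact (ω x).map_update_add v i a b
  · intro _ v i c a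
    refine eq_of_evalAt_eq fun x => ?_
    rw [map_smul, key, key]
    exact (ω x).map_update_smul v i c a
  · intro v i j hij hne
    refine eq_of_evalAt_eq fun x => ?_
    rw [map_zero, key]
    exact (ω x).map_eq_zero_of_eq v hij hne
  · funext x
    ext v
    exact key v x

/-- The total degree is at most the integer `s` (so the polynomial is zero if `s < 0`). -/
def DegLE {n : ℕ} (p : MvPolynomial (Fin n) ℝ) (s : ℤ) : Prop :=
  ∀ m ∈ p.support, (m.degree : ℤ) ≤ s

theorem DegLE.zero {n : ℕ} (s : ℤ) : DegLE (0 : MvPolynomial (Fin n) ℝ) s := by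
  intro m hm; simp at hm

theorem DegLE.add {n : ℕ} {p q : MvPolynomial (Fin n) ℝ} {s : ℤ} (hp : DegLE p s)
    (hq : DegLE q s) : DegLE (p + q) s := fun m hm =>
  (Finset.mem_union.1 (MvPolynomial.support_add hm)).elim (hp m) (hq m)

theorem DegLE.sub {n : ℕ} {p q : MvPolynomial (Fin n) ℝ} {s : ℤ} (hp : DegLE p s)
    (hq : DegLE q s) : DegLE (p - q) s := fun m hm =>
  (Finset.mem_union.1 (MvPolynomial.support_sub _ p q hm)).elim (hp m) (hq m)

theorem DegLE.mono {n : ℕ} {p : MvPolynomial (Fin n) ℝ} {s t : ℤ} (hp : DegLE p s)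
    (h : s ≤ t) : DegLE p t := fun m hm => (hp m hm).trans h

theorem DegLE.sum {n : ℕ} {ι : Type*} {t : Finset ι} {p : ι → MvPolynomial (Fin n) ℝ} {s : ℤ}
    (hp : ∀ i ∈ t, DegLE (p i) s) : DegLE (∑ i ∈ t, p i) s :=
  Finset.sum_induction p (DegLE · s) (fun _ _ => DegLE.add) (DegLE.zero s) hp

theorem DegLE.mul {n : ℕ} {p q : MvPolynomial (Fin n) ℝ} {s t : ℤ} (hp : DegLE p s)
    (hq : DegLE q t) : DegLE (p * q) (s + t) := by
  intro m hm
  obtain ⟨a, ha, b, hb, rfl⟩ := Finset.mem_add.1 (MvPolynomial.support_mul p q hm)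
  have := hp a ha
  have := hq b hb
  rw [map_add]
  push_cast
  linarith

theorem DegLE.C {n : ℕ} (c : ℝ) : DegLE (C c : MvPolynomial (Fin n) ℝ) 0 := by
  intro m hm
  have : m = 0 := by
    by_contra h
    simp [MvPolynomial.coeff_C, Ne.symm h] at hm
  simp [this]

theorem DegLE.X {n : ℕ} (i : Fin n) : DegLE (X i : MvPolynomial (Fin n) ℝ) 1 := by
  intro m hm
  rw [MvPolynomial.support_X, Finset.mem_singleton] at hm
  simp [hm]

theorem DegLE.eq_zero {n : ℕ} {p : MvPolynomial (Fin n) ℝ} {s : ℤ} (hp : DegLE p s)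
    (hs : s < 0) : p = 0 := by
  rw [← MvPolynomial.support_eq_empty, Finset.eq_empty_iff_forall_notMem]
  intro m hm
  have := hp m hm
  omega

theorem degLE_iff_totalDegree_le {n : ℕ} {p : MvPolynomial (Fin n) ℝ} (hp : p ≠ 0) {s : ℤ} :
    DegLE p s ↔ (p.totalDegree : ℤ) ≤ s := by
  constructor
  · intro h
    obtain ⟨m, hm, hd⟩ := Finset.exists_mem_eq_sup p.support
      (by rwa [Finset.nonempty_iff_ne_empty, Ne, MvPolynomial.support_eq_empty])
      (fun m => m.sum fun _ e => e)
    have := h m hm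
    have e : p.totalDegree = m.degree := by
      rw [MvPolynomial.totalDegree, hd]; rfl
    omega
  · intro h m hm
    have : m.degree ≤ p.totalDegree := MvPolynomial.le_totalDegree hm
    omega

theorem eq_zero_of_degLE_of_isHomogeneous {n : ℕ} {p : MvPolynomial (Fin n) ℝ} {s : ℤ} {d : ℕ}
    (hp : DegLE p s) (hd : p.IsHomogeneous d) (h : s < d) : p = 0 := by
  by_contra h0
  have := (degLE_iff_totalDegree_le h0).1 hp
  rw [hd.totalDegree h0] at this
  omega

theorem evalForm_mem_PForm {n k : ℕ} {Q : PolyAlt n k} {s : ℤ} (hQ : ∀ v, DegLE (Q v) s) :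
    evalForm Q ∈ PForm n s k := fun v => ⟨Q v, hQ v, fun x => evalAt_apply x _⟩

/-! ### The Koszul complex of polynomial forms -/

/-- The directional derivative of polynomials. -/
noncomputable def dirDeriv {n : ℕ} (v : E n) :
    MvPolynomial (Fin n) ℝ →ₗ[ℝ] MvPolynomial (Fin n) ℝ :=
  ∑ j, v j • (MvPolynomial.pderiv j).toLinearMap

theorem dirDeriv_apply {n : ℕ} (v : E n) (p : MvPolynomial (Fin n) ℝ) :
    dirDeriv v p = ∑ j, v j • MvPolynomial.pderiv j p := by
  simp [dirDeriv]

/-- The exterior derivative of a form with polynomial coefficients. -/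
noncomputable def extDerivPoly {n k : ℕ} (Q : PolyAlt n k) : PolyAlt n (k + 1) :=
  AlternatingMap.alternatizeUncurryFin
    { toFun := fun v => (dirDeriv v).compAlternatingMap Q
      map_add' := fun v w => by
        ext1 u
        simp [dirDeriv_apply, add_smul, Finset.sum_add_distrib]
      map_smul' := fun c v => by
        ext1 u
        simp [dirDeriv_apply, mul_smul, Finset.smul_sum] }

theorem extDerivPoly_apply {n k : ℕ} (Q : PolyAlt n k) (u : Fin (k + 1) → E n) :
    extDerivPoly Q u = ∑ i : Fin (k + 1), (-1 : ℤ) ^ (i : ℕ) • dirDeriv (u i) (Q (i.removeNth u)) := by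
  rw [extDerivPoly, AlternatingMap.alternatizeUncurryFin_apply]
  rfl

/-- The Koszul operator on forms with polynomial coefficients. -/
noncomputable def koszulPoly {n k : ℕ} (Q : PolyAlt n (k + 1)) : PolyAlt n k :=
  ∑ j, (X j : MvPolynomial (Fin n) ℝ) • Q.curryLeft (EuclideanSpace.basisFun (Fin n) ℝ j)

theorem koszulPoly_apply {n k : ℕ} (Q : PolyAlt n (k + 1)) (u : Fin k → E n) :
    koszulPoly Q u =
      ∑ j, X j * Q (Matrix.vecCons (EuclideanSpace.basisFun (Fin n) ℝ j) u) := by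
  simp [koszulPoly, alternatingMap_sum_apply]

theorem sum_smul_basisFun {n : ℕ} (v : E n) :
    ∑ j, v j • EuclideanSpace.basisFun (Fin n) ℝ j = v := by
  simpa using (EuclideanSpace.basisFun (Fin n) ℝ).sum_repr v

theorem map_vecCons_eq_sum {n k : ℕ} (Q : PolyAlt n (k + 1)) (v : E n) (u : Fin k → E n) :
    Q (Matrix.vecCons v u) =
      ∑ j, v j • Q (Matrix.vecCons (EuclideanSpace.basisFun (Fin n) ℝ j) u) := by
  have := congrArg (fun w => Q.curryLeft w u) (sum_smul_basisFun v)
  simpa [alternatingMap_sum_apply] using this.symm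

theorem koszul_evalForm {n k : ℕ} (Q : PolyAlt n (k + 1)) :
    koszul n k (evalForm Q) = evalForm (koszulPoly Q) := by
  funext x
  ext u
  change evalAt x (Q (Matrix.vecCons x u)) = evalAt x (koszulPoly Q u)
  rw [map_vecCons_eq_sum, koszulPoly_apply]
  simp [evalAt_apply]

/-- Product rule for Σ x_j Q(e_j, w): differentiating the factors x_j along v leaves Σ v_j Q(e_j, w)
= Q(v, w). -/
theorem sum_X_mul_dirDeriv {n k : ℕ} (Q : PolyAlt n (k + 1)) (v : E n) (w : Fin k → E n) :
    ∑ j, X j * dirDeriv v (Q (Matrix.vecCons (EuclideanSpace.basisFun (Fin n) ℝ j) w)) =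
      dirDeriv v (koszulPoly Q w) - Q (Matrix.vecCons v w) := by
  rw [eq_sub_iff_add_eq, map_vecCons_eq_sum, koszulPoly_apply, map_sum, ← Finset.sum_add_distrib]
  refine Finset.sum_congr rfl fun j _ => ?_
  rw [dirDeriv_apply, dirDeriv_apply]
  simp only [Derivation.leibniz, smul_eq_mul, smul_add, Finset.sum_add_distrib,
    MvPolynomial.pderiv_X, Finset.mul_sum, mul_smul_comm]
  congr 1
  rw [Finset.sum_eq_single j]
  · simp
  · intro b _ hb
    simp [hb]
  · simp

theorem sum_X_mul_dirDeriv_basisFun {n s : ℕ} {p : MvPolynomial (Fin n) ℝ}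
    (hp : p.IsHomogeneous s) :
    ∑ j, X j * dirDeriv (EuclideanSpace.basisFun (Fin n) ℝ j) p = (s : ℝ) • p := by
  have : ∀ j, dirDeriv (EuclideanSpace.basisFun (Fin n) ℝ j) p = MvPolynomial.pderiv j p := by
    intro j
    rw [dirDeriv_apply, Finset.sum_eq_single j]
    · simp
    · intro b _ hb
      simp [hb]
    · simp
  simp_rw [this]
  rw [hp.sum_X_mul_pderiv, Nat.cast_smul_eq_nsmul]

theorem koszulPoly_extDerivPoly_zero {n s : ℕ} {H : PolyAlt n 0}
    (hH : ∀ v, (H v).IsHomogeneous s) :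
    koszulPoly (extDerivPoly H) = (s : ℝ) • H := by
  ext1 u
  rw [koszulPoly_apply, AlternatingMap.smul_apply, ← sum_X_mul_dirDeriv_basisFun (hH u)]
  refine Finset.sum_congr rfl fun j _ => ?_
  rw [extDerivPoly_apply]
  simp [Subsingleton.elim _ u]

/-- The homotopy formula κd + dκ = s + (form degree), on the kernel of κ. In κdH the term
differentiating along the contracted vector gives sH by Euler's identity. The others, by the product
rule and κH = 0, give the alternating sum of H(u_i, …), which is (k + 1)H. -/
theorem koszulPoly_extDerivPoly {n k s : ℕ} {H : PolyAlt n (k + 1)}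
    (hH : ∀ v, (H v).IsHomogeneous s) (hκ : koszulPoly H = 0) :
    koszulPoly (extDerivPoly H) = ((s : ℝ) + (k + 1)) • H := by
  ext1 u
  have h2 : (((k : ℝ) + 1) • H) u =
      ∑ i : Fin (k + 1), (-1 : ℤ) ^ (i : ℕ) • H (Matrix.vecCons (u i) (i.removeNth u)) := by
    have := congrArg (fun F => F u) (AlternatingMap.alternatizeUncurryFin_curryLeft H)
    simp only [AlternatingMap.alternatizeUncurryFin_apply, AlternatingMap.curryLeft_apply_apply]
      at this
    rw [this, ← Nat.cast_smul_eq_nsmul ℝ]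
    push_cast
    rfl
  rw [add_smul, AlternatingMap.add_apply, h2, AlternatingMap.smul_apply,
    ← sum_X_mul_dirDeriv_basisFun (hH u), koszulPoly_apply]
  simp_rw [extDerivPoly_apply, Fin.sum_univ_succ (n := k + 1), mul_add, Finset.mul_sum]
  rw [Finset.sum_add_distrib]
  congr 1
  · refine Finset.sum_congr rfl fun j _ => ?_
    simp [Matrix.vecCons]
  · rw [Finset.sum_comm]
    refine Finset.sum_congr rfl fun i _ => ?_
    have h3 := sum_X_mul_dirDeriv H (u i) (i.removeNth u)
    rw [hκ] at h3
    simp only [AlternatingMap.zero_apply, map_zero, zero_sub] at h3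
    rw [← neg_eq_iff_eq_neg] at h3
    rw [← h3, ← Finset.sum_neg_distrib, Finset.smul_sum]
    refine Finset.sum_congr rfl fun j _ => ?_
    have h4 : Fin.removeNth i.succ
        (Matrix.vecCons (EuclideanSpace.basisFun (Fin n) ℝ j) u) =
        Matrix.vecCons (EuclideanSpace.basisFun (Fin n) ℝ j) (i.removeNth u) := by
      funext t
      refine Fin.cases ?_ (fun t => ?_) t
      · simp [Fin.removeNth]
      · simp [Fin.removeNth]
    rw [h4]
    simp only [Fin.val_succ, pow_succ, Matrix.cons_val_succ, mul_smul_comm]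
    simp

theorem mem_support_dirDeriv {n s : ℕ} {p : MvPolynomial (Fin n) ℝ} (hp : p.IsHomogeneous s)
    (v : E n) : ∀ m ∈ (dirDeriv v p).support, (m.degree : ℤ) = s - 1 := by
  intro m hm
  rw [MvPolynomial.mem_support_iff, dirDeriv_apply, MvPolynomial.coeff_sum] at hm
  obtain ⟨j, -, hj⟩ := Finset.exists_ne_zero_of_sum_ne_zero hm
  rw [MvPolynomial.coeff_smul, MvPolynomial.coeff_pderiv] at hj
  have h1 : (m + Finsupp.single j 1).degree = s := by
    rw [Finsupp.degree_eq_weight_one]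
    exact hp (left_ne_zero_of_mul (right_ne_zero_of_mul hj))
  rw [map_add] at h1
  simp at h1
  omega

theorem mem_support_extDerivPoly {n k s : ℕ} {H : PolyAlt n k}
    (hH : ∀ v, (H v).IsHomogeneous s) (u : Fin (k + 1) → E n) :
    ∀ m ∈ (extDerivPoly H u).support, (m.degree : ℤ) = s - 1 := by
  intro m hm
  rw [MvPolynomial.mem_support_iff, extDerivPoly_apply, MvPolynomial.coeff_sum] at hm
  obtain ⟨i, -, hi⟩ := Finset.exists_ne_zero_of_sum_ne_zero hm
  refine mem_support_dirDeriv (hH (i.removeNth u)) (u i) m (MvPolynomial.mem_support_iff.2 ?_)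
  intro h0
  apply hi
  rcases neg_one_pow_eq_or ℤ (i : ℕ) with h | h <;> rw [h] <;> simp [h0]

theorem evalForm_add {n k : ℕ} (P Q : PolyAlt n k) :
    evalForm (P + Q) = evalForm P + evalForm Q := by
  funext x
  ext v
  exact map_add (evalAt x) (P v) (Q v)

theorem evalForm_smul {n k : ℕ} (c : ℝ) (Q : PolyAlt n k) :
    evalForm (c • Q) = c • evalForm Q := by
  funext x
  ext v
  exact map_smul (evalAt x) c (Q v)

/-- H = κ(c⁻¹ dH) is the Koszul part, and Q - H has lower degree. -/
theorem evalForm_mem_PMinusForm {n k s : ℕ} {Q H : PolyAlt n k} {c : ℝ} (hc : c ≠ 0)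
    (hH : ∀ v, (H v).IsHomogeneous s) (hQH : ∀ v, DegLE ((Q - H) v) (s - 1))
    (hκ : koszulPoly (extDerivPoly H) = c • H) :
    evalForm Q ∈ PMinusForm n s k := by
  have h1 : evalForm Q = evalForm (Q - H) +
      koszul n k (c⁻¹ • evalForm (extDerivPoly H)) := by
    rw [map_smul, koszul_evalForm, hκ, evalForm_smul, smul_smul, inv_mul_cancel₀ hc, one_smul,
      ← evalForm_add, sub_add_cancel]
  rw [h1]
  refine Submodule.add_mem_sup (evalForm_mem_PForm hQH) (Submodule.mem_map_of_mem
    (Submodule.smul_mem _ _ fun v => ?_))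
  exact ⟨extDerivPoly H v, mem_support_extDerivPoly hH v, fun x => evalAt_apply x _⟩

theorem degLE_sub_homogeneousComponent {n s : ℕ} {p : MvPolynomial (Fin n) ℝ} (hp : DegLE p s) :
    DegLE (p - MvPolynomial.homogeneousComponent s p) (s - 1) := by
  intro m hm
  rw [MvPolynomial.mem_support_iff, MvPolynomial.coeff_sub,
    MvPolynomial.coeff_homogeneousComponent] at hm
  split_ifs at hm with h
  · simp at hm
  · rw [sub_zero] at hm
    have := hp m (MvPolynomial.mem_support_iff.2 hm)
    omega

theorem evalForm_mem_PMinusForm_zero {n : ℕ} {s : ℤ} (hs : 0 < s) {Q : PolyAlt n 0}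
    (hQ : ∀ v, DegLE (Q v) s) : evalForm Q ∈ PMinusForm n s 0 := by
  lift s to ℕ using hs.le
  have hH : ∀ v, ((MvPolynomial.homogeneousComponent s).compAlternatingMap Q v).IsHomogeneous s :=
    fun v => MvPolynomial.homogeneousComponent_isHomogeneous s _
  exact evalForm_mem_PMinusForm (c := s) (by exact_mod_cast hs.ne') hH
    (fun v => degLE_sub_homogeneousComponent (hQ v)) (koszulPoly_extDerivPoly_zero hH)

/-- If H is the degree s part of Q, then κH is the degree s + 1 part of κQ, which the bound on κQ
forces to be zero. The homotopy formula then applies to H. -/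
theorem evalForm_mem_PMinusForm_succ {n k : ℕ} {s : ℤ} {Q : PolyAlt n (k + 1)}
    (hQ : ∀ v, DegLE (Q v) s) (hκQ : ∀ v, DegLE (koszulPoly Q v) s) :
    evalForm Q ∈ PMinusForm n s (k + 1) := by
  rcases lt_or_ge s 0 with hs | hs
  · have : Q = 0 := by
      ext1 v
      exact (hQ v).eq_zero hs
    rw [this]
    exact Submodule.zero_mem _
  lift s to ℕ using hs
  set H : PolyAlt n (k + 1) := (MvPolynomial.homogeneousComponent s).compAlternatingMap Q with hHdef
  have hH : ∀ v, (H v).IsHomogeneous s :=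
    fun v => MvPolynomial.homogeneousComponent_isHomogeneous s _
  have hQH : ∀ v, DegLE ((Q - H) v) (s - 1) := fun v => degLE_sub_homogeneousComponent (hQ v)
  have hκH : koszulPoly H = 0 := by
    ext1 u
    have h1 : koszulPoly H u = koszulPoly Q u - koszulPoly (Q - H) u := by
      simp only [koszulPoly_apply, ← Finset.sum_sub_distrib]
      refine Finset.sum_congr rfl fun j _ => ?_
      rw [AlternatingMap.sub_apply]
      ring
    have h2 : DegLE (koszulPoly H u) s := by
      rw [h1]
      refine (hκQ u).sub ?_
      rw [koszulPoly_apply]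
      exact DegLE.sum fun j _ => ((DegLE.X j).mul (hQH _)).mono (by linarith)
    refine eq_zero_of_degLE_of_isHomogeneous (d := 1 + s) h2 ?_ (by push_cast; linarith)
    rw [koszulPoly_apply]
    exact MvPolynomial.IsHomogeneous.sum _ _ _ fun j _ =>
      (MvPolynomial.isHomogeneous_X ℝ j).mul (hH _)
  exact evalForm_mem_PMinusForm (by positivity) hH hQH (koszulPoly_extDerivPoly hH hκH)

/-! ### Interior multiplication of a top form -/

/-- The interior product of a form on `ι ⊕ κ` arguments with a family of vectors. -/
noncomputable def interiorMul {V ι κ : Type*} [AddCommGroup V] [Module ℝ V]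
    (D : V [⋀^ι ⊕ κ]→ₗ[ℝ] ℝ) (w : ι → V) : V [⋀^κ]→ₗ[ℝ] ℝ where
  toFun u := D (Sum.elim w u)
  map_update_add' _ _ _ _ := by
    classical
    simp only [Sum.elim_update_right, AlternatingMap.map_update_add]
  map_update_smul' _ _ _ _ := by
    classical
    simp only [Sum.elim_update_right, AlternatingMap.map_update_smul]
  map_eq_zero_of_eq' := by
    intro u i j hij hne
    exact D.map_eq_zero_of_eq (Sum.elim w u) (i := Sum.inr i) (j := Sum.inr j) hij
      (fun h => hne (Sum.inr_injective h))

theorem interiorMul_apply {V ι κ : Type*} [AddCommGroup V] [Module ℝ V]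
    (D : V [⋀^ι ⊕ κ]→ₗ[ℝ] ℝ) (w : ι → V) (u : κ → V) :
    interiorMul D w u = D (Sum.elim w u) := rfl

/-- Only the trivial shuffle survives: any other feeds some vector of the first block to
`interiorMul`, where it already occurs. -/
theorem mul'_domCoprod_interiorMul_self {V ι κ : Type*} [AddCommGroup V] [Module ℝ V]
    [Fintype ι] [Fintype κ] [DecidableEq ι] [DecidableEq κ]
    (a : V [⋀^ι]→ₗ[ℝ] ℝ) (D : V [⋀^ι ⊕ κ]→ₗ[ℝ] ℝ) (v : ι ⊕ κ → V) :
    LinearMap.mul' ℝ ℝ (a.domCoprod (interiorMul D (v ∘ Sum.inl)) v) =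
      a (v ∘ Sum.inl) * D v := by
  classical
  rw [AlternatingMap.domCoprod_apply, _root_.sum_apply, map_sum]
  refine (Finset.sum_eq_single (Quotient.mk'' 1 : Equiv.Perm.ModSumCongr ι κ)
    ?_ ?_).trans ?_
  · intro q _ hq
    induction q using Quotient.inductionOn' with | _ σ
    rw [AlternatingMap.domCoprod.summand_mk'']
    have hσ : ∃ j i, σ (Sum.inr j) = Sum.inl i := by
      by_contra! h
      apply hq
      refine (Quotient.sound' (QuotientGroup.leftRel_apply.2 ?_)).symm
      rw [inv_one, one_mul, ← inv_mem_iff]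
      refine Equiv.Perm.mem_sumCongrHom_range_of_perm_mapsTo_inl ?_
      rintro _ ⟨i, rfl⟩
      rcases hi : σ⁻¹ (Sum.inl i) with i' | j
      · exact ⟨i', rfl⟩
      · exact absurd (Equiv.Perm.inv_eq_iff_eq.1 hi).symm (h j i)
    obtain ⟨j, i, hji⟩ := hσ
    have h0 : interiorMul D (v ∘ Sum.inl) (fun t => v (σ (Sum.inr t))) = 0 := by
      rw [interiorMul_apply]
      exact D.map_eq_zero_of_eq _ (i := Sum.inl i) (j := Sum.inr j) (by simp [hji]) (by simp)
    simp [h0]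
  · simp
  · rw [AlternatingMap.domCoprod.summand_mk'']
    simp [interiorMul_apply, Function.comp_def]
    left
    congr 1
    ext i
    rcases i with i | i <;> rfl

/-- Both sides are top-degree forms evaluated at b, so b may be traded for a basis extending w, the
case already settled. If w is dependent, both sides vanish. -/
theorem mul'_domCoprod_interiorMul {V ι κ : Type*} [AddCommGroup V] [Module ℝ V]
    [Fintype ι] [Fintype κ] [DecidableEq ι] [DecidableEq κ] (b : Module.Basis (ι ⊕ κ) ℝ V)
    (a : V [⋀^ι]→ₗ[ℝ] ℝ) (D : V [⋀^ι ⊕ κ]→ₗ[ℝ] ℝ) (w : ι → V) :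
    LinearMap.mul' ℝ ℝ (a.domCoprod (interiorMul D w) b) = a w * D b := by
  classical
  by_cases hw : LinearIndependent ℝ w
  · have : Module.Finite ℝ V := Module.Finite.of_basis b
    let b₁ := Module.Basis.sumExtend hw
    have : Fintype (Module.Basis.sumExtendIndex hw) := by
      have := Module.Finite.finite_basis b₁
      have : Finite (Module.Basis.sumExtendIndex hw) :=
        Finite.of_injective (Sum.inr : _ → ι ⊕ _) Sum.inr_injective
      exact Fintype.ofFinite _
    have hcard : Fintype.card (Module.Basis.sumExtendIndex hw) = Fintype.card κ := by
      have h1 := Module.finrank_eq_card_basis b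
      have h2 := Module.finrank_eq_card_basis b₁
      rw [h1, Fintype.card_sum, Fintype.card_sum] at h2
      omega
    let b₂ : Module.Basis (ι ⊕ κ) ℝ V :=
      b₁.reindex (Equiv.sumCongr (Equiv.refl ι) (Fintype.equivOfCardEq hcard))
    have hb₂ : b₂ ∘ Sum.inl = w := by
      funext i
      simp [b₂, b₁, Module.Basis.sumExtend]
      rfl
    have h1 := mul'_domCoprod_interiorMul_self a D b₂
    rw [hb₂] at h1
    set F : V [⋀^ι ⊕ κ]→ₗ[ℝ] ℝ :=
      (LinearMap.mul' ℝ ℝ).compAlternatingMap (a.domCoprod (interiorMul D w)) with hF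
    change F b₂ = _ at h1
    change F b = _
    rw [F.eq_smul_basis_det b₂, AlternatingMap.smul_apply, h1]
    conv_rhs => rw [D.eq_smul_basis_det b₂]
    simp [mul_assoc]
  · rw [a.map_linearDependent w hw, zero_mul]
    have : interiorMul D w = 0 := by
      ext u
      rw [interiorMul_apply]
      refine D.map_linearDependent _ fun h => hw ?_
      exact h.comp Sum.inl Sum.inl_injective
    rw [this]
    rw [← AlternatingMap.domCoprod'_apply, TensorProduct.tmul_zero, map_zero,
      AlternatingMap.zero_apply, map_zero]

/-! ### Barycentric coordinates as polynomials -/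

/-- The vertices of an `n`-simplex in `ℝⁿ` as an affine basis. -/
noncomputable def vertexBasis {n : ℕ} (T : Affine.Simplex ℝ (E n) n) :
    AffineBasis (Fin (n + 1)) ℝ (E n) where
  toFun := T.points
  ind' := T.independent
  tot' := by
    rw [T.independent.affineSpan_eq_top_iff_card_eq_finrank_add_one]
    simp

theorem body_eq {n : ℕ} (T : Affine.Simplex ℝ (E n) n) :
    body T = convexHull ℝ (Set.range (vertexBasis T)) := by
  rw [body, subsimplex, Finset.coe_univ, Set.image_univ]
  rfl

/-- The polynomial whose values are the barycentric coordinate of a point. -/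
noncomputable def baryPoly {n : ℕ} (T : Affine.Simplex ℝ (E n) n) (i : Fin (n + 1)) :
    MvPolynomial (Fin n) ℝ :=
  C ((vertexBasis T).coord i 0) +
    ∑ j, C (((vertexBasis T).coord i).linear (EuclideanSpace.basisFun (Fin n) ℝ j)) * X j

theorem evalAt_baryPoly {n : ℕ} (T : Affine.Simplex ℝ (E n) n) (i : Fin (n + 1)) (x : E n) :
    evalAt x (baryPoly T i) = (vertexBasis T).coord i x := by
  have h := ((vertexBasis T).coord i).map_vadd 0 x
  simp only [vadd_eq_add, add_zero] at h
  rw [h, ← congrArg ((vertexBasis T).coord i).linear (sum_smul_basisFun x), evalAt_apply, baryPoly,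
    add_comm]
  simp only [map_add, map_sum, map_mul, map_smul, MvPolynomial.eval_C, MvPolynomial.eval_X,
    smul_eq_mul]
  congr 1
  exact Finset.sum_congr rfl fun j _ => mul_comm _ _

theorem degLE_baryPoly {n : ℕ} (T : Affine.Simplex ℝ (E n) n) (i : Fin (n + 1)) :
    DegLE (baryPoly T i) 1 :=
  ((DegLE.C _).mono zero_le_one).add
    (DegLE.sum fun j _ => ((DegLE.C _).mul (DegLE.X j)).mono (by norm_num))

theorem evalAt_mul {n : ℕ} (x : E n) (p q : MvPolynomial (Fin n) ℝ) :
    evalAt x (p * q) = evalAt x p * evalAt x q := by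
  simp [evalAt_apply]

theorem evalAt_prod {n : ℕ} {ι : Type*} (x : E n) (t : Finset ι)
    (p : ι → MvPolynomial (Fin n) ℝ) :
    evalAt x (∏ i ∈ t, p i) = ∏ i ∈ t, evalAt x (p i) := by
  simp [evalAt_apply, map_prod]

theorem exists_linear_coord_eq_one {n : ℕ} (T : Affine.Simplex ℝ (E n) n) {i j : Fin (n + 1)}
    (hij : i ≠ j) : ∃ u : E n, ((vertexBasis T).coord i).linear u = 1 := by
  refine ⟨vertexBasis T i - vertexBasis T j, ?_⟩
  have := ((vertexBasis T).coord i).linearMap_vsub (vertexBasis T i) (vertexBasis T j)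
  rw [vsub_eq_sub] at this
  rw [this]
  simp [hij]

theorem coord_sub_smul {n : ℕ} (T : Affine.Simplex ℝ (E n) n) {i : Fin (n + 1)} {u : E n}
    (hu : ((vertexBasis T).coord i).linear u = 1) (x : E n) :
    (vertexBasis T).coord i (x - (vertexBasis T).coord i x • u) = 0 := by
  have h := ((vertexBasis T).coord i).map_vadd x (-((vertexBasis T).coord i x • u))
  rw [vadd_eq_add, neg_add_eq_sub] at h
  rw [h, map_neg, map_smul, hu]
  simp

/-- The ring homomorphism that restricts polynomials to the hyperplane where a barycentric
coordinate vanishes, by projection along `u`. -/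
noncomputable def restrictHom {n : ℕ} (T : Affine.Simplex ℝ (E n) n) (i : Fin (n + 1)) (u : E n) :
    MvPolynomial (Fin n) ℝ →ₐ[ℝ] MvPolynomial (Fin n) ℝ :=
  MvPolynomial.aeval fun j => X j - baryPoly T i * C (u j)

theorem evalAt_restrictHom {n : ℕ} (T : Affine.Simplex ℝ (E n) n) (i : Fin (n + 1)) (u x : E n)
    (p : MvPolynomial (Fin n) ℝ) :
    evalAt x (restrictHom T i u p) = evalAt (x - (vertexBasis T).coord i x • u) p := by
  have : ((MvPolynomial.aeval (fun j => x j) : MvPolynomial (Fin n) ℝ →ₐ[ℝ] ℝ).comp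
      (restrictHom T i u)) =
      MvPolynomial.aeval (fun j => (x - (vertexBasis T).coord i x • u) j) := by
    refine MvPolynomial.algHom_ext fun j => ?_
    have := evalAt_baryPoly T i x
    rw [evalAt_apply] at this
    simp [restrictHom, MvPolynomial.aeval_eq_eval, this]
  exact congrArg (fun F => F p) this

theorem baryPoly_dvd_sub_restrictHom {n : ℕ} (T : Affine.Simplex ℝ (E n) n) (i : Fin (n + 1))
    (u : E n) (p : MvPolynomial (Fin n) ℝ) : baryPoly T i ∣ p - restrictHom T i u p := by
  rw [← Ideal.mem_span_singleton, ← Ideal.Quotient.mk_eq_mk_iff_sub_mem]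
  have : (Ideal.Quotient.mkₐ ℝ (Ideal.span {baryPoly T i})).comp (restrictHom T i u) =
      Ideal.Quotient.mkₐ ℝ (Ideal.span {baryPoly T i}) := by
    refine MvPolynomial.algHom_ext fun j => ?_
    simp only [AlgHom.comp_apply, Ideal.Quotient.mkₐ_eq_mk, restrictHom, MvPolynomial.aeval_X]
    rw [Ideal.Quotient.mk_eq_mk_iff_sub_mem, Ideal.mem_span_singleton]
    exact ⟨-C (u j), by ring⟩
  exact (congrArg (fun F => F p) this).symm

/-- Modulo λ_i, p agrees with its pullback under the projection x ↦ x - λ_i(x)u onto the hyperplane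
λ_i = 0, and that pullback is zero. -/
theorem baryPoly_dvd_of_forall_eq_zero {n : ℕ} (T : Affine.Simplex ℝ (E n) n) (i : Fin (n + 1))
    {p : MvPolynomial (Fin n) ℝ}
    (hp : ∀ x : E n, (vertexBasis T).coord i x = 0 → evalAt x p = 0) : baryPoly T i ∣ p := by
  by_cases hn : ∃ j, i ≠ j
  · obtain ⟨j, hij⟩ := hn
    obtain ⟨u, hu⟩ := exists_linear_coord_eq_one T hij
    have h := baryPoly_dvd_sub_restrictHom T i u p
    have h0 : restrictHom T i u p = 0 := eq_of_evalAt_eq fun x => by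
      rw [evalAt_restrictHom, hp _ (coord_sub_smul T hu x), map_zero]
    rwa [h0, sub_zero] at h
  -- There is a single vertex, so n = 0 and λ_i = 1.
  · push Not at hn
    have : baryPoly T i = 1 := eq_of_evalAt_eq fun x => by
      have h := (vertexBasis T).sum_coord_apply_eq_one x
      rw [Finset.sum_eq_single i (fun j _ hj => absurd (hn j).symm hj) (by simp)] at h
      rw [evalAt_baryPoly, h]
      simp [evalAt_apply]
    rw [this]
    exact one_dvd _

/-- λ_i generates the kernel of `restrictHom`, a homomorphism into a domain. -/
theorem prime_baryPoly {n : ℕ} (T : Affine.Simplex ℝ (E n) n) {i j : Fin (n + 1)}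
    (hij : i ≠ j) : Prime (baryPoly T i) := by
  obtain ⟨u, hu⟩ := exists_linear_coord_eq_one T hij
  have hi := evalAt_baryPoly T i (vertexBasis T i)
  have hj := evalAt_baryPoly T i (vertexBasis T j)
  rw [AffineBasis.coord_apply_eq] at hi
  rw [AffineBasis.coord_apply_ne _ hij] at hj
  have key : ∀ p, restrictHom T i u p = 0 → baryPoly T i ∣ p := fun p hp => by
    simpa [hp] using baryPoly_dvd_sub_restrictHom T i u p
  have key2 : restrictHom T i u (baryPoly T i) = 0 := eq_of_evalAt_eq fun x => by
    rw [evalAt_restrictHom, evalAt_baryPoly, coord_sub_smul T hu, map_zero]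
  refine ⟨?_, ?_, ?_⟩
  · intro h
    rw [h, map_zero] at hi
    exact zero_ne_one hi
  · intro h
    have := h.map (MvPolynomial.eval (fun k => vertexBasis T j k))
    rw [← evalAt_apply, hj] at this
    exact not_isUnit_zero this
  · rintro a b ⟨c, hc⟩
    have := congrArg (restrictHom T i u) hc
    rw [map_mul, map_mul, key2, zero_mul] at this
    exact (mul_eq_zero.1 this).imp (key a) (key b)

theorem prod_baryPoly_dvd {n : ℕ} (T : Affine.Simplex ℝ (E n) n) {p : MvPolynomial (Fin n) ℝ}
    (hp : ∀ i, baryPoly T i ∣ p) : ∏ i, baryPoly T i ∣ p := by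
  refine Finset.prod_dvd_of_isRelPrime (fun i _ j _ hij => ?_) fun i _ => hp i
  refine (prime_baryPoly T hij).irreducible.isRelPrime_iff_not_dvd.2 ?_
  rintro ⟨c, hc⟩
  have := congrArg (evalAt (vertexBasis T j)) hc
  rw [evalAt_mul, evalAt_baryPoly, evalAt_baryPoly, AffineBasis.coord_apply_eq,
    AffineBasis.coord_apply_ne _ hij, zero_mul] at this
  exact one_ne_zero this

theorem prod_baryPoly_ne_zero {n : ℕ} (T : Affine.Simplex ℝ (E n) n) :
    ∏ i, baryPoly T i ≠ 0 := by
  refine Finset.prod_ne_zero_iff.2 fun i _ h => ?_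
  have := evalAt_baryPoly T i (vertexBasis T i)
  rw [AffineBasis.coord_apply_eq, h, map_zero] at this
  exact zero_ne_one this

theorem one_le_totalDegree_baryPoly {n : ℕ} (T : Affine.Simplex ℝ (E n) n) {i j : Fin (n + 1)}
    (hij : i ≠ j) : 1 ≤ (baryPoly T i).totalDegree := by
  rw [Nat.one_le_iff_ne_zero]
  intro h
  rw [MvPolynomial.totalDegree_eq_zero_iff_eq_C] at h
  have hi := evalAt_baryPoly T i (vertexBasis T i)
  have hj := evalAt_baryPoly T i (vertexBasis T j)
  rw [AffineBasis.coord_apply_eq, h, evalAt_apply, MvPolynomial.eval_C] at hi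
  rw [AffineBasis.coord_apply_ne _ hij, h, evalAt_apply, MvPolynomial.eval_C] at hj
  exact one_ne_zero (hi.symm.trans hj)

theorem DegLE.of_prod_baryPoly_mul {n : ℕ} (hn : 0 < n) (T : Affine.Simplex ℝ (E n) n)
    {q : MvPolynomial (Fin n) ℝ} {s : ℤ} (h : DegLE ((∏ i, baryPoly T i) * q) s) :
    DegLE q (s - (n + 1)) := by
  by_cases hq : q = 0
  · rw [hq]
    exact DegLE.zero _
  have hj : ∀ i : Fin (n + 1), ∃ j, i ≠ j := fun i => by
    have : Nontrivial (Fin (n + 1)) := Fin.nontrivial_iff_two_le.2 (by omega)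
    exact (exists_ne i).imp fun _ h => h.symm
  have hne : ∀ i, baryPoly T i ≠ 0 := fun i => (prime_baryPoly T (hj i).choose_spec).ne_zero
  have key : ∀ t : Finset (Fin (n + 1)),
      t.card + q.totalDegree ≤ ((∏ i ∈ t, baryPoly T i) * q).totalDegree := by
    intro t
    induction t using Finset.induction_on with
    | empty => simp
    | insert a t ha ih =>
      rw [Finset.prod_insert ha, Finset.card_insert_of_notMem ha, mul_assoc,
        MvPolynomial.totalDegree_mul_of_isDomain (hne a)
          (mul_ne_zero (Finset.prod_ne_zero_iff.2 fun i _ => hne i) hq)]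
      have := one_le_totalDegree_baryPoly T (hj a).choose_spec
      omega
  have h1 := key Finset.univ
  rw [degLE_iff_totalDegree_le (mul_ne_zero (prod_baryPoly_ne_zero T) hq)] at h
  rw [degLE_iff_totalDegree_le hq]
  simp at h1
  omega

/-! ### Polynomials vanishing on faces -/

/-- Along the line from a to x, p is a polynomial in t with infinitely many zeros, so it also
vanishes at t = 1. -/
theorem evalAt_eq_zero_of_eventually_lineMap {n : ℕ} {p : MvPolynomial (Fin n) ℝ} {a x : E n}
    (h : ∀ᶠ t in nhdsWithin (0 : ℝ) (Set.Ioi 0), evalAt (AffineMap.lineMap a x t) p = 0) :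
    evalAt x p = 0 := by
  let P : Polynomial ℝ :=
    MvPolynomial.aeval (fun j => Polynomial.C (a j) + Polynomial.X * Polynomial.C (x j - a j)) p
  have hP : ∀ t : ℝ, P.eval t = evalAt (AffineMap.lineMap a x t) p := by
    intro t
    have : ((Polynomial.aeval t : Polynomial ℝ →ₐ[ℝ] ℝ).comp (MvPolynomial.aeval
        (fun j => Polynomial.C (a j) + Polynomial.X * Polynomial.C (x j - a j)))) =
        (MvPolynomial.aeval (fun j => (AffineMap.lineMap a x t : E n) j) :
          MvPolynomial (Fin n) ℝ →ₐ[ℝ] ℝ) := by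
      refine MvPolynomial.algHom_ext fun j => ?_
      simp [AffineMap.lineMap_apply, add_comm]
    have h2 := congrArg (fun F => F p) this
    simpa [Polynomial.aeval_def, P, evalAt_apply] using h2
  obtain ⟨δ, hδ, hsub⟩ := mem_nhdsGT_iff_exists_Ioo_subset.1 h
  have hP0 : P = 0 := Polynomial.eq_zero_of_infinite_isRoot P
    ((Set.Ioo_infinite hδ).mono fun t ht => (hP t).trans (hsub ht))
  simpa [hP0] using (hP 1).symm

theorem exists_coord_eq {n : ℕ} (T : Affine.Simplex ℝ (E n) n) {w : Fin (n + 1) → ℝ}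
    (hw : ∑ i, w i = 1) : ∃ a : E n, ∀ i, (vertexBasis T).coord i a = w i :=
  ⟨Finset.univ.affineCombination ℝ (vertexBasis T) w, fun i =>
    (vertexBasis T).coord_apply_combination_of_mem (Finset.mem_univ i) hw⟩

theorem eventually_coord_lineMap_pos {n : ℕ} (T : Affine.Simplex ℝ (E n) n) {i : Fin (n + 1)}
    {a x : E n} (ha : 0 < (vertexBasis T).coord i a) :
    ∀ᶠ t in nhdsWithin (0 : ℝ) (Set.Ioi 0),
      0 < (vertexBasis T).coord i (AffineMap.lineMap a x t) := by
  simp_rw [AffineMap.apply_lineMap]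
  have hc : Continuous fun t : ℝ =>
      AffineMap.lineMap ((vertexBasis T).coord i a) ((vertexBasis T).coord i x) t :=
    AffineMap.lineMap_continuous
  have := hc.tendsto 0
  rw [AffineMap.lineMap_apply_zero] at this
  exact nhdsWithin_le_nhds (this.eventually (lt_mem_nhds ha))

theorem eq_zero_of_evalAt_eq_zero_of_coord_pos {n : ℕ} (T : Affine.Simplex ℝ (E n) n)
    {p : MvPolynomial (Fin n) ℝ}
    (hp : ∀ x, (∀ i, 0 < (vertexBasis T).coord i x) → evalAt x p = 0) : p = 0 := by
  refine eq_of_evalAt_eq fun x => ?_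
  rw [map_zero]
  obtain ⟨a, ha⟩ := exists_coord_eq T (w := fun _ => ((n : ℝ) + 1)⁻¹)
    (by simp; field_simp)
  refine evalAt_eq_zero_of_eventually_lineMap (a := a) ?_
  filter_upwards [Filter.eventually_all.2 fun i => eventually_coord_lineMap_pos T (i := i) (x := x)
    (by rw [ha]; positivity : 0 < (vertexBasis T).coord i a)] with t ht
  exact hp _ ht

theorem mem_facet_of_coord_nonneg {n : ℕ} (T : Affine.Simplex ℝ (E n) n) {i : Fin (n + 1)}
    {x : E n} (h0 : (vertexBasis T).coord i x = 0) (hx : ∀ j, 0 ≤ (vertexBasis T).coord j x) :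
    x ∈ subsimplex T {i}ᶜ := by
  rw [← (vertexBasis T).linear_combination_coord_eq_self x,
    ← Finset.sum_subset (Finset.subset_univ {i}ᶜ) (by
      intro j _ hj
      have : j = i := by simpa using hj
      rw [this, h0, zero_smul])]
  refine (convex_convexHull ℝ _).sum_mem (fun j _ => hx j) ?_ fun j hj =>
    subset_convexHull ℝ _ ⟨j, by simpa using hj, rfl⟩
  rw [← (vertexBasis T).sum_coord_apply_eq_one x]
  refine Finset.sum_subset (Finset.subset_univ _) fun j _ hj => ?_
  have : j = i := by simpa using hj
  rw [this, h0]

theorem coord_eq_zero_of_mem_facet {n : ℕ} (T : Affine.Simplex ℝ (E n) n) {i : Fin (n + 1)}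
    {x : E n} (hx : x ∈ subsimplex T {i}ᶜ) : (vertexBasis T).coord i x = 0 := by
  have hc : Convex ℝ {x : E n | (vertexBasis T).coord i x = 0} :=
    (convex_singleton (0 : ℝ)).affine_preimage ((vertexBasis T).coord i)
  refine convexHull_min ?_ hc hx
  rintro _ ⟨j, hj, rfl⟩
  refine (vertexBasis T).coord_apply_ne ?_
  rintro rfl
  simp at hj

/-- A segment from the barycentre of the facet towards any point of its hyperplane starts inside the
facet, so vanishing spreads to the hyperplane. -/
theorem baryPoly_dvd_of_forall_mem_facet {n : ℕ} (T : Affine.Simplex ℝ (E n) n) (i : Fin (n + 1))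
    {p : MvPolynomial (Fin n) ℝ} (hp : ∀ x ∈ subsimplex T {i}ᶜ, evalAt x p = 0) :
    baryPoly T i ∣ p := by
  refine baryPoly_dvd_of_forall_eq_zero T i fun x hx => ?_
  have hn : n ≠ 0 := by
    rintro rfl
    have := (vertexBasis T).sum_coord_apply_eq_one x
    rw [Fin.fin_one_eq_zero i] at hx
    rw [Fin.sum_univ_one, hx] at this
    exact zero_ne_one this
  have hn' : (0 : ℝ) < n := by positivity
  obtain ⟨a, ha⟩ := exists_coord_eq T (w := fun j => if j = i then 0 else (n : ℝ)⁻¹) (by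
    simp [Finset.sum_ite, Finset.filter_ne', hn'.ne'])
  refine evalAt_eq_zero_of_eventually_lineMap (a := a) ?_
  have hev : ∀ᶠ t in nhdsWithin (0 : ℝ) (Set.Ioi 0),
      ∀ j, j ≠ i → 0 < (vertexBasis T).coord j (AffineMap.lineMap a x t) := by
    refine Filter.eventually_all.2 fun j => ?_
    by_cases hj : j = i
    · simp [hj]
    · filter_upwards [eventually_coord_lineMap_pos T (i := j) (x := x)
        (by rw [ha, if_neg hj]; positivity : 0 < (vertexBasis T).coord j a)] with t ht _
      exact ht
  filter_upwards [hev] with t ht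
  have hi0 : (vertexBasis T).coord i (AffineMap.lineMap a x t) = 0 := by
    rw [AffineMap.apply_lineMap, ha, hx]
    simp
  refine hp _ (mem_facet_of_coord_nonneg T hi0 fun j => ?_)
  by_cases hj : j = i
  · rw [hj, hi0]
  · exact (ht j hj).le

/-! ### Functions given by polynomials -/

theorem mem_polyFun_iff {n : ℕ} {s : ℤ} {f : E n → ℝ} :
    f ∈ polyFun n (fun d => (d : ℤ) ≤ s) ↔
      ∃ p : MvPolynomial (Fin n) ℝ, DegLE p s ∧ ∀ x, f x = evalAt x p := by
  simp only [evalAt_apply]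
  exact Iff.rfl

theorem DegLE.of_mem_polyFun {n : ℕ} {s : ℤ} {p : MvPolynomial (Fin n) ℝ}
    (h : (fun x => evalAt x p) ∈ polyFun n (fun d => (d : ℤ) ≤ s)) : DegLE p s := by
  obtain ⟨q, hq, hpq⟩ := mem_polyFun_iff.1 h
  rwa [eq_of_evalAt_eq hpq]

theorem polyFun_mono {n : ℕ} {s t : ℤ} (h : s ≤ t) {f : E n → ℝ}
    (hf : f ∈ polyFun n (fun d => (d : ℤ) ≤ s)) : f ∈ polyFun n (fun d => (d : ℤ) ≤ t) := by
  obtain ⟨p, hp, hpf⟩ := mem_polyFun_iff.1 hf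
  exact mem_polyFun_iff.2 ⟨p, hp.mono h, hpf⟩

theorem mul_mem_polyFun {n : ℕ} {s t : ℤ} {f g : E n → ℝ}
    (hf : f ∈ polyFun n (fun d => (d : ℤ) ≤ s)) (hg : g ∈ polyFun n (fun d => (d : ℤ) ≤ t)) :
    (fun x => f x * g x) ∈ polyFun n (fun d => (d : ℤ) ≤ s + t) := by
  obtain ⟨p, hp, hpf⟩ := mem_polyFun_iff.1 hf
  obtain ⟨q, hq, hqg⟩ := mem_polyFun_iff.1 hg
  exact mem_polyFun_iff.2 ⟨p * q, hp.mul hq, fun x => by rw [evalAt_mul, hpf, hqg]⟩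

theorem sum_mem_polyFun {n : ℕ} {D : ℕ → Prop} {ι : Type*} {t : Finset ι} {f : ι → E n → ℝ}
    (hf : ∀ i ∈ t, f i ∈ polyFun n D) : (fun x => ∑ i ∈ t, f i x) ∈ polyFun n D := by
  have : (fun x => ∑ i ∈ t, f i x) = ∑ i ∈ t, f i := by
    funext x
    rw [Finset.sum_apply]
  rw [this]
  exact Submodule.sum_mem _ hf

theorem const_mem_polyFun {n : ℕ} (c : ℝ) :
    (fun _ : E n => c) ∈ polyFun n (fun d => (d : ℤ) ≤ 0) :=
  mem_polyFun_iff.2 ⟨C c, DegLE.C c, fun x => by simp [evalAt_apply]⟩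

theorem linear_mem_polyFun {n : ℕ} (f : E n →ₗ[ℝ] ℝ) :
    (fun x => f x) ∈ polyFun n (fun d => (d : ℤ) ≤ 1) := by
  refine mem_polyFun_iff.2 ⟨∑ j, X j * C (f (EuclideanSpace.basisFun (Fin n) ℝ j)),
    DegLE.sum fun j _ => ((DegLE.X j).mul (DegLE.C _)).mono (by norm_num), fun x => ?_⟩
  conv_lhs => rw [← sum_smul_basisFun x]
  rw [map_sum, map_sum]
  simp [evalAt_apply]

theorem prod_coord_mem_polyFun {n k : ℕ} (T : Affine.Simplex ℝ (E n) n)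
    (I : Fin k → Fin (n + 1)) :
    (fun x => ∏ j, (vertexBasis T).coord (I j) x) ∈ polyFun n (fun d => (d : ℤ) ≤ k) := by
  refine mem_polyFun_iff.2 ⟨∏ j, baryPoly T (I j), ?_, fun x => ?_⟩
  · suffices ∀ t : Finset (Fin k), DegLE (∏ j ∈ t, baryPoly T (I j)) t.card by
      simpa using this Finset.univ
    intro t
    induction t using Finset.induction_on with
    | empty => simpa using DegLE.C (n := n) 1
    | insert a t ha ih =>
      rw [Finset.prod_insert ha, Finset.card_insert_of_notMem ha]
      exact ((degLE_baryPoly T _).mul ih).mono (by push_cast; linarith)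
  · rw [evalAt_prod]
    simp_rw [evalAt_baryPoly]

/-- Expand in every slot: by alternation, terms with x in two slots vanish, leaving degree at most
one. -/
theorem alternating_sub_mem_polyFun {n k : ℕ} (f : (E n) [⋀^Fin k]→ₗ[ℝ] ℝ) (v : Fin k → E n) :
    (fun x => f fun j => v j - x) ∈ polyFun n (fun d => (d : ℤ) ≤ 1) := by
  have h : (fun x => f fun j => v j - x) =
      fun x => ∑ s : Finset (Fin k), f (s.piecewise v fun _ => -x) := by
    funext x
    refine Eq.trans ?_ (MultilinearMap.map_add_univ f.toMultilinearMap v fun _ => -x)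
    simp only [sub_eq_add_neg]
    rfl
  rw [h]
  refine sum_mem_polyFun fun s _ => ?_
  by_cases hs : ∃ i, i ∉ s
  · obtain ⟨i, hi⟩ := hs
    by_cases hs2 : ∀ j, j ∉ s → j = i
    · have : (fun x : E n => f (s.piecewise v fun _ => -x)) =
          fun x => (-f.toMultilinearMap.toLinearMap v i) x := by
        funext x
        have h1 : s.piecewise v (fun _ => -x) = Function.update v i (-x) := by
          funext j
          by_cases hj : j = i
          · subst hj
            simp [hi]
          · have : j ∈ s := by
              by_contra h
              exact hj (hs2 j h)
            simp [this, hj]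
        rw [h1, AlternatingMap.map_update_neg]
        rfl
      rw [this]
      exact linear_mem_polyFun _
    · push Not at hs2
      obtain ⟨j, hj, hji⟩ := hs2
      have : (fun x : E n => f (s.piecewise v fun _ => -x)) = 0 := by
        funext x
        exact f.map_eq_zero_of_eq _ (i := j) (j := i) (by simp [hi, hj]) hji
      rw [this]
      exact Submodule.zero_mem _
  · push Not at hs
    have : s = Finset.univ := Finset.eq_univ_of_forall hs
    subst this
    simpa using polyFun_mono zero_le_one (const_mem_polyFun (n := n) (f v))

theorem multilinearMap_map_add_const {ι R V N : Type*} [Fintype ι] [CommSemiring R]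
    [AddCommMonoid V] [AddCommMonoid N] [Module R V] [Module R N]
    (f : MultilinearMap R (fun _ : ι => V) N) {y : V} (hf : ∀ w j, w j = y → f w = 0)
    (v : ι → V) : f (v + fun _ => y) = f v := by
  classical
  rw [MultilinearMap.map_add_univ, Finset.sum_eq_single Finset.univ]
  · simp
  · intro s _ hs
    obtain ⟨j, hj⟩ : ∃ j, j ∉ s := by
      by_contra! h
      exact hs (Finset.eq_univ_of_forall h)
    exact hf _ j (by simp [hj])
  · simp

/-! ### The dual form -/

/-- The left side depends on y, w and c only through the tensor Σ c_i y_i ⊗ w_i, so y may be changed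
whenever that tensor is unchanged. -/
theorem sum_prod_mul_map_mul_map {n k : ℕ} {ι : Type*} [Fintype ι]
    (a b : MultilinearMap ℝ (fun _ : Fin k => E n) ℝ) (c : ι → ℝ) (y w : ι → E n) :
    ∑ I : Fin k → ι, (∏ j, c (I j)) * a (fun j => y (I j)) * b (fun j => w (I j)) =
      ∑ J : Fin k → Fin n, a (fun j => EuclideanSpace.basisFun (Fin n) ℝ (J j)) *
        b (fun j => ∑ i, (c i * y i (J j)) • w i) := by
  classical
  have ha : ∀ I : Fin k → ι, a (fun j => y (I j)) = ∑ J : Fin k → Fin n,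
      (∏ j, y (I j) (J j)) * a (fun j => EuclideanSpace.basisFun (Fin n) ℝ (J j)) := by
    intro I
    conv_lhs => enter [2, j]; rw [← sum_smul_basisFun (y (I j))]
    rw [MultilinearMap.map_sum]
    simp_rw [MultilinearMap.map_smul_univ, smul_eq_mul]
  have hb : ∀ J : Fin k → Fin n, b (fun j => ∑ i, (c i * y i (J j)) • w i) =
      ∑ I : Fin k → ι, (∏ j, c (I j)) * (∏ j, y (I j) (J j)) * b (fun j => w (I j)) := by
    intro J
    rw [MultilinearMap.map_sum]
    simp_rw [MultilinearMap.map_smul_univ, smul_eq_mul, Finset.prod_mul_distrib]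
  simp_rw [ha, hb, Finset.mul_sum, Finset.sum_mul]
  rw [Finset.sum_comm]
  refine Finset.sum_congr rfl fun J _ => Finset.sum_congr rfl fun I _ => ?_
  ring

theorem sum_coord_smul_sub {n : ℕ} (T : Affine.Simplex ℝ (E n) n) (x : E n) :
    ∑ i, (vertexBasis T).coord i x • (vertexBasis T i - x) = 0 := by
  simp_rw [smul_sub]
  rw [Finset.sum_sub_distrib, (vertexBasis T).linear_combination_coord_eq_self, ← Finset.sum_smul,
    (vertexBasis T).sum_coord_apply_eq_one, one_smul, sub_self]

/-- Σ λ_i x ⊗ (v_i - x) = 0. The left form keeps the degree in x low; the right form shows vanishing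
on facets and positivity. -/
theorem sum_prod_coord_mul_map_mul_map_sub {n k : ℕ} (T : Affine.Simplex ℝ (E n) n) (x : E n)
    (a b : (E n) [⋀^Fin k]→ₗ[ℝ] ℝ) :
    ∑ I : Fin k → Fin (n + 1), (∏ j, (vertexBasis T).coord (I j) x) *
        a (fun j => vertexBasis T (I j)) * b (fun j => vertexBasis T (I j) - x) =
      ∑ I : Fin k → Fin (n + 1), (∏ j, (vertexBasis T).coord (I j) x) *
        a (fun j => vertexBasis T (I j) - x) * b (fun j => vertexBasis T (I j) - x) := by
  have h1 := sum_prod_mul_map_mul_map a.toMultilinearMap b.toMultilinearMap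
    (fun i => (vertexBasis T).coord i x) (fun i => vertexBasis T i) (fun i => vertexBasis T i - x)
  have h2 := sum_prod_mul_map_mul_map a.toMultilinearMap b.toMultilinearMap
    (fun i => (vertexBasis T).coord i x) (fun i => vertexBasis T i - x)
    (fun i => vertexBasis T i - x)
  refine h1.trans (Eq.trans ?_ h2.symm)
  refine Finset.sum_congr rfl fun J _ => ?_
  congr 2
  funext j
  have h3 : ∀ i, ((vertexBasis T).coord i x * (vertexBasis T i - x) (J j)) •
      (vertexBasis T i - x) = ((vertexBasis T).coord i x * vertexBasis T i (J j)) •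
        (vertexBasis T i - x) - x (J j) • ((vertexBasis T).coord i x • (vertexBasis T i - x)) := by
    intro i
    rw [smul_smul, ← sub_smul]
    congr 1
    simp
    ring
  simp_rw [h3]
  rw [Finset.sum_sub_distrib, ← Finset.smul_sum, sum_coord_smul_sub, smul_zero, sub_zero]

/-- The standard basis of `ℝ^(k+l)`, indexed by a sum type. -/
noncomputable def sumBasis (k l : ℕ) : Module.Basis (Fin k ⊕ Fin l) ℝ (E (k + l)) :=
  (EuclideanSpace.basisFun (Fin (k + l)) ℝ).toBasis.reindex finSumFinEquiv.symm

/-- The `l`-form dual to the `k`-covector `a` at the point `x`: the contraction of the volume form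
with the multivector which `a` corresponds to under the inner product
`⟨dλ_i, dλ_j⟩ = λ_i δ_ij - λ_i λ_j` on covectors, where `λ_i` are the barycentric coordinates. -/
noncomputable def dualAt {k l : ℕ} (T : Affine.Simplex ℝ (E (k + l)) (k + l)) (x : E (k + l))
    (a : (E (k + l)) [⋀^Fin k]→ₗ[ℝ] ℝ) : (E (k + l)) [⋀^Fin l]→ₗ[ℝ] ℝ :=
  ∑ I : Fin k → Fin (k + l + 1),
    ((∏ j, (vertexBasis T).coord (I j) x) * a (fun j => vertexBasis T (I j))) •
      interiorMul (sumBasis k l).det (fun j => vertexBasis T (I j) - x)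

theorem dualAt_apply {k l : ℕ} (T : Affine.Simplex ℝ (E (k + l)) (k + l)) (x : E (k + l))
    (a : (E (k + l)) [⋀^Fin k]→ₗ[ℝ] ℝ) (u : Fin l → E (k + l)) :
    dualAt T x a u = ∑ I : Fin k → Fin (k + l + 1),
      (∏ j, (vertexBasis T).coord (I j) x) * a (fun j => vertexBasis T (I j)) *
        (sumBasis k l).det (Sum.elim (fun j => vertexBasis T (I j) - x) u) := by
  rw [dualAt, alternatingMap_sum_apply]
  rfl

/-- The form on the first block of arguments obtained by fixing the second block. -/
noncomputable def fixRight {V ι κ : Type*} [AddCommGroup V] [Module ℝ V]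
    (D : V [⋀^ι ⊕ κ]→ₗ[ℝ] ℝ) (u : κ → V) : V [⋀^ι]→ₗ[ℝ] ℝ :=
  interiorMul (D.domDomCongr (Equiv.sumComm ι κ)) u

theorem fixRight_apply {V ι κ : Type*} [AddCommGroup V] [Module ℝ V]
    (D : V [⋀^ι ⊕ κ]→ₗ[ℝ] ℝ) (u : κ → V) (w : ι → V) :
    fixRight D u w = D (Sum.elim w u) := by
  change D _ = D _
  congr 1
  funext i
  rcases i with i | i <;> rfl

theorem dualAt_apply_eq_sub {k l : ℕ} (T : Affine.Simplex ℝ (E (k + l)) (k + l)) (x : E (k + l))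
    (a : (E (k + l)) [⋀^Fin k]→ₗ[ℝ] ℝ) (u : Fin l → E (k + l)) :
    dualAt T x a u = ∑ I : Fin k → Fin (k + l + 1),
      (∏ j, (vertexBasis T).coord (I j) x) * a (fun j => vertexBasis T (I j) - x) *
        (sumBasis k l).det (Sum.elim (fun j => vertexBasis T (I j) - x) u) := by
  rw [dualAt_apply]
  simp_rw [← fixRight_apply]
  exact sum_prod_coord_mul_map_mul_map_sub T x a _

theorem topCoeff_wedge {k l : ℕ} (a : (E (k + l)) [⋀^Fin k]→ₗ[ℝ] ℝ)
    (b : (E (k + l)) [⋀^Fin l]→ₗ[ℝ] ℝ) :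
    topCoeff rfl (wedge a b) = LinearMap.mul' ℝ ℝ (a.domCoprod b (sumBasis k l)) := by
  have : (fun i => EuclideanSpace.basisFun (Fin (k + l)) ℝ (Fin.cast rfl (finSumFinEquiv i))) =
      sumBasis k l := by
    funext i
    simp [sumBasis]
  rw [← this]
  rfl

theorem topCoeff_wedge_smul {k l : ℕ} (a : (E (k + l)) [⋀^Fin k]→ₗ[ℝ] ℝ)
    (c : ℝ) (b : (E (k + l)) [⋀^Fin l]→ₗ[ℝ] ℝ) :
    topCoeff rfl (wedge a (c • b)) = c * topCoeff rfl (wedge a b) := by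
  rw [topCoeff_wedge, topCoeff_wedge, ← AlternatingMap.domCoprod'_apply,
    ← AlternatingMap.domCoprod'_apply, TensorProduct.tmul_smul, map_smul,
    AlternatingMap.smul_apply, map_smul, smul_eq_mul]

theorem topCoeff_wedge_dualAt {k l : ℕ} (T : Affine.Simplex ℝ (E (k + l)) (k + l))
    (x : E (k + l)) (a : (E (k + l)) [⋀^Fin k]→ₗ[ℝ] ℝ) :
    topCoeff rfl (wedge a (dualAt T x a)) = ∑ I : Fin k → Fin (k + l + 1),
      (∏ j, (vertexBasis T).coord (I j) x) * (a fun j => vertexBasis T (I j) - x) ^ 2 := by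
  have h := sum_prod_coord_mul_map_mul_map_sub T x a a
  simp_rw [pow_two, ← mul_assoc]
  rw [← h, topCoeff_wedge, dualAt, ← AlternatingMap.domCoprod'_apply, TensorProduct.tmul_sum,
    map_sum, alternatingMap_sum_apply, map_sum]
  refine Finset.sum_congr rfl fun I _ => ?_
  rw [TensorProduct.tmul_smul, map_smul, AlternatingMap.smul_apply, map_smul,
    AlternatingMap.domCoprod'_apply, mul'_domCoprod_interiorMul, Module.Basis.det_self, mul_one,
    smul_eq_mul]

theorem dualAt_mem_formsWithCoeffs {k l : ℕ} (T : Affine.Simplex ℝ (E (k + l)) (k + l)) {s : ℤ}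
    {ω : Form (k + l) k} (hω : ω ∈ PForm (k + l) s k) :
    (fun x => dualAt T x (ω x)) ∈ PForm (k + l) (s + k + 1) l := by
  intro u
  simp_rw [dualAt_apply]
  refine sum_mem_polyFun fun I _ => ?_
  refine mul_mem_polyFun (polyFun_mono (by linarith)
    (mul_mem_polyFun (prod_coord_mem_polyFun T I) (hω fun j => vertexBasis T (I j)))) ?_
  simp_rw [← fixRight_apply]
  exact alternating_sub_mem_polyFun _ _

/-- With x already among the arguments of the determinant, v_I - x may be replaced by v_I. The
determinant is then linear in x, so κ does not raise the degree bound. -/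
theorem koszul_dualAt_mem_formsWithCoeffs {k l : ℕ}
    (T : Affine.Simplex ℝ (E (k + (l + 1))) (k + (l + 1))) {s : ℤ}
    {ω : Form (k + (l + 1)) k} (hω : ω ∈ PForm (k + (l + 1)) s k) :
    koszul (k + (l + 1)) l (fun x => dualAt T x (ω x)) ∈ PForm (k + (l + 1)) (s + k + 1) l := by
  intro u
  change (fun x => dualAt T x (ω x) (Matrix.vecCons x u)) ∈ _
  simp_rw [dualAt_apply]
  refine sum_mem_polyFun fun I _ => ?_
  refine mul_mem_polyFun (polyFun_mono (by linarith)
    (mul_mem_polyFun (prod_coord_mem_polyFun T I) (hω fun j => vertexBasis T (I j)))) ?_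
  have h : (fun x => (sumBasis k (l + 1)).det
      (Sum.elim (fun j => vertexBasis T (I j) - x) (Matrix.vecCons x u))) =
      fun x => ((interiorMul (sumBasis k (l + 1)).det
        fun j => vertexBasis T (I j)).curryLeft x) u := by
    funext x
    change _ = (sumBasis k (l + 1)).det (Sum.elim _ (Matrix.vecCons x u))
    rw [← fixRight_apply, ← fixRight_apply]
    refine Eq.trans ?_ (multilinearMap_map_add_const (fixRight (sumBasis k (l + 1)).det
      (Matrix.vecCons x u)).toMultilinearMap (y := -x) ?_ fun j => vertexBasis T (I j))
    · simp only [sub_eq_add_neg]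
      rfl
    · intro w j hj
      change fixRight _ _ w = 0
      rw [← Function.update_eq_self j w, hj, AlternatingMap.map_update_neg, neg_eq_zero,
        fixRight_apply]
      exact AlternatingMap.map_eq_zero_of_eq _ _ (i := Sum.inl j) (j := Sum.inr 0)
        (by simp) (by simp)
  rw [h]
  set F := (interiorMul (sumBasis k (l + 1)).det fun j => vertexBasis T (I j)).curryLeft
  exact linear_mem_polyFun
    { toFun := fun x => F x u
      map_add' := fun x y => by rw [map_add, AlternatingMap.add_apply]
      map_smul' := fun c x => by rw [map_smul, AlternatingMap.smul_apply, RingHom.id_apply] }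

theorem dualAt_eq_zero_of_mem_facet {k l : ℕ} (T : Affine.Simplex ℝ (E (k + l)) (k + l)) {s : ℤ}
    {ω : Form (k + l) k} (hω : ω ∈ PRingForm T s k) {i : Fin (k + l + 1)} {x : E (k + l)}
    (hx : x ∈ subsimplex T {i}ᶜ) : dualAt T x (ω x) = 0 := by
  ext u
  rw [dualAt_apply_eq_sub]
  refine Finset.sum_eq_zero fun I _ => ?_
  by_cases hI : ∃ j, I j = i
  · obtain ⟨j, hj⟩ := hI
    rw [Finset.prod_eq_zero (Finset.mem_univ j) (by rw [hj, coord_eq_zero_of_mem_facet T hx]),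
      zero_mul, zero_mul]
  · push Not at hI
    have hv : ∀ j, vertexBasis T (I j) - x ∈ vectorSpan ℝ (subsimplex T {i}ᶜ) := fun j =>
      vsub_mem_vectorSpan ℝ
        (subset_convexHull ℝ _ ⟨I j, by simpa using hI j, rfl⟩) hx
    have h := hω.2 {i}ᶜ (by simp) x hx
    have h2 : (ω x fun j => vertexBasis T (I j) - x) = 0 :=
      congrArg (fun F => F fun j => (⟨_, hv j⟩ : vectorSpan ℝ (subsimplex T {i}ᶜ))) h
    rw [h2, mul_zero, zero_mul]

/-- Division of a polynomial form by a nonzero polynomial that divides all its coefficients. -/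
theorem exists_smul_eq_of_forall_dvd {n k : ℕ} {p : MvPolynomial (Fin n) ℝ} (hp : p ≠ 0)
    {Q : PolyAlt n k} (h : ∀ u, p ∣ Q u) : ∃ R : PolyAlt n k, p • R = Q := by
  choose q hq using h
  refine ⟨{ toFun := q, map_update_add' := ?_, map_update_smul' := ?_,
            map_eq_zero_of_eq' := ?_ }, ?_⟩
  · intro _ v i a b
    refine mul_left_cancel₀ hp ?_
    rw [mul_add, ← hq, ← hq, ← hq, AlternatingMap.map_update_add]
  · intro _ v i c a
    refine mul_left_cancel₀ hp ?_
    rw [mul_smul_comm, ← hq, ← hq, AlternatingMap.map_update_smul]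
  · intro v i j hij hne
    refine mul_left_cancel₀ hp ?_
    rw [mul_zero, ← hq, Q.map_eq_zero_of_eq v hij hne]
  · ext1 v
    exact (hq v).symm

theorem degLE_of_isEmpty (p : MvPolynomial (Fin 0) ℝ) : DegLE p 0 := fun m _ => by
  simp [Subsingleton.elim m 0]

theorem exists_mem_PMinusForm_smul_eq_dualAt {k l r : ℕ} (hr : 1 ≤ r)
    (T : Affine.Simplex ℝ (E (k + l)) (k + l)) {ω : Form (k + l) k}
    (hω : ω ∈ PRingForm T r k) :
    ∃ Q : PolyAlt (k + l) l, evalForm Q ∈ PMinusForm (k + l) ((r : ℤ) - l) l ∧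
      ∀ x, (∏ i, (vertexBasis T).coord i x) • evalForm Q x = dualAt T x (ω x) := by
  have hB := dualAt_mem_formsWithCoeffs T hω.1
  obtain ⟨P, hP, hPdeg⟩ := exists_evalForm_eq hB
  have hdvd : ∀ u, ∏ i, baryPoly T i ∣ P u := fun u => prod_baryPoly_dvd T fun i =>
    baryPoly_dvd_of_forall_mem_facet T i fun x hx => by
      have h1 := congrArg (fun F => F x u) hP
      simp only [evalForm_apply, dualAt_eq_zero_of_mem_facet T hω hx] at h1
      exact h1
  obtain ⟨Q, hQ⟩ := exists_smul_eq_of_forall_dvd (prod_baryPoly_ne_zero T) hdvd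
  have hdiv : ∀ q : MvPolynomial (Fin (k + l)) ℝ,
      DegLE ((∏ i, baryPoly T i) * q) (r + k + 1) → DegLE q (r - l) := by
    intro q hq
    -- For n = 0 the bubble is the constant 1, so dividing by it lowers no degree; but there are no
    -- variables either.
    rcases Nat.eq_zero_or_pos (k + l) with h0 | h0
    · obtain ⟨rfl, rfl⟩ := Nat.add_eq_zero_iff.1 h0
      exact (degLE_of_isEmpty q).mono (by simp)
    · refine (hq.of_prod_baryPoly_mul h0).mono ?_
      push_cast
      linarith
  have hQdeg : ∀ u, DegLE (Q u) (r - l) := fun u => hdiv _ (by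
    have := hPdeg u
    rwa [← hQ] at this)
  refine ⟨Q, ?_, fun x => ?_⟩
  · cases l with
    | zero =>
      -- For functions the homotopy constant is the degree r itself, nonzero because r ≥ 1.
      refine evalForm_mem_PMinusForm_zero (by push_cast; omega) hQdeg
    | succ l =>
      refine evalForm_mem_PMinusForm_succ hQdeg fun u => hdiv _ ?_
      have h1 : (∏ i, baryPoly T i) * koszulPoly Q u = koszulPoly P u := by
        rw [koszulPoly_apply, koszulPoly_apply, Finset.mul_sum, ← hQ]
        refine Finset.sum_congr rfl fun j _ => ?_
        rw [AlternatingMap.smul_apply, smul_eq_mul]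
        ring
      rw [h1]
      refine DegLE.of_mem_polyFun ?_
      have h2 := koszul_dualAt_mem_formsWithCoeffs T hω.1 u
      rw [← hP, koszul_evalForm] at h2
      exact h2
  · rw [← congrFun hP x, ← hQ]
    ext u
    rw [AlternatingMap.smul_apply, evalForm_apply, evalForm_apply, AlternatingMap.smul_apply,
      smul_eq_mul, smul_eq_mul, evalAt_mul, evalAt_prod]
    simp_rw [evalAt_baryPoly]

/-! ### Positivity of the pairing with the dual form -/

theorem continuous_evalAt {n : ℕ} (p : MvPolynomial (Fin n) ℝ) :
    Continuous fun x : E n => evalAt x p := by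
  simp_rw [evalAt_apply]
  exact (MvPolynomial.continuous_eval p).comp (PiLp.continuous_ofLp 2 _)

theorem continuous_topCoeff_wedge_evalForm {k l : ℕ} (P : PolyAlt (k + l) k)
    (Q : PolyAlt (k + l) l) :
    Continuous fun x => topCoeff rfl (wedge (evalForm P x) (evalForm Q x)) := by
  simp_rw [topCoeff_wedge, AlternatingMap.domCoprod_apply, _root_.sum_apply, map_sum]
  refine continuous_finsetSum _ fun σ _ => ?_
  induction σ using Quotient.inductionOn' with | _ σ
  simp_rw [AlternatingMap.domCoprod.summand_mk'']
  rcases Int.units_eq_one_or (Equiv.Perm.sign σ) with h | h <;> rw [h]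
  · simp only [one_smul]
    exact (continuous_evalAt (P _)).mul (continuous_evalAt (Q _))
  · simp only [Units.neg_smul, one_smul, _root_.neg_apply, map_neg]
    exact ((continuous_evalAt (P _)).mul (continuous_evalAt (Q _))).neg

theorem alternating_eq_zero_of_vertices {n k : ℕ} (T : Affine.Simplex ℝ (E n) n) {x : E n}
    {a : (E n) [⋀^Fin k]→ₗ[ℝ] ℝ}
    (h : ∀ I : Fin k → Fin (n + 1), (a fun j => vertexBasis T (I j) - x) = 0) : a = 0 := by
  ext u
  have hu : ∀ y : E n, ∑ i, (vertexBasis T).coord i (x + y) • (vertexBasis T i - x) = y := by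
    intro y
    simp_rw [smul_sub]
    rw [Finset.sum_sub_distrib, (vertexBasis T).linear_combination_coord_eq_self,
      ← Finset.sum_smul, (vertexBasis T).sum_coord_apply_eq_one, one_smul, add_sub_cancel_left]
  have h1 : (fun j => u j) =
      fun j => ∑ i, (vertexBasis T).coord i (x + u j) • (vertexBasis T i - x) := by
    funext j
    rw [hu]
  change a.toMultilinearMap (fun j => u j) = 0
  rw [h1, MultilinearMap.map_sum]
  refine Finset.sum_eq_zero fun I _ => ?_
  rw [MultilinearMap.map_smul_univ]
  exact smul_eq_zero_of_right _ (h I)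

theorem interior_body {n : ℕ} (T : Affine.Simplex ℝ (E n) n) :
    interior (body T) = {x | ∀ i, 0 < (vertexBasis T).coord i x} := by
  rw [body_eq]
  exact (vertexBasis T).interior_convexHull

theorem isCompact_body {n : ℕ} (T : Affine.Simplex ℝ (E n) n) : IsCompact (body T) := by
  rw [body_eq]
  exact (Set.finite_range _).isCompact_convexHull ℝ

theorem ae_restrict_body_mem_interior {n : ℕ} (T : Affine.Simplex ℝ (E n) n) :
    ∀ᵐ x ∂volume.restrict (body T), x ∈ interior (body T) := by
  rw [ae_restrict_iff' (isCompact_body T).measurableSet]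
  have hconv : Convex ℝ (body T) := convex_convexHull ℝ _
  filter_upwards [compl_mem_ae_iff.2 (hconv.addHaar_frontier volume)] with x hx hxT
  by_contra h
  exact hx ⟨subset_closure hxT, h⟩

theorem sum_prod_coord_mul_sq_nonneg {n k : ℕ} (T : Affine.Simplex ℝ (E n) n) {x : E n}
    (hx : ∀ i, 0 < (vertexBasis T).coord i x) (a : (E n) [⋀^Fin k]→ₗ[ℝ] ℝ)
    (I : Fin k → Fin (n + 1)) :
    0 ≤ (∏ j, (vertexBasis T).coord (I j) x) * (a fun j => vertexBasis T (I j) - x) ^ 2 :=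
  mul_nonneg (Finset.prod_nonneg fun _ _ => (hx _).le) (sq_nonneg _)

theorem eq_zero_of_forall_integralForm_eq_zero {k l r : ℕ} (hr : 1 ≤ r)
    (T : Affine.Simplex ℝ (E (k + l)) (k + l)) {e : E (k + l) → ℝ}
    (he_pos : ∀ x ∈ body T, 0 < e x) (he_int : IntegrableOn e (body T) volume)
    {ω : Form (k + l) k} (hω : ω ∈ PRingForm T r k)
    (hmoments : ∀ η ∈ PMinusForm (k + l) ((r : ℤ) - l) l,
      integralForm rfl T (fun x => e x • wedge (ω x) (η x)) = 0) :
    ω = 0 := by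
  obtain ⟨Q, hQ, hQω⟩ := exists_mem_PMinusForm_smul_eq_dualAt hr T hω
  obtain ⟨P, rfl, -⟩ := exists_evalForm_eq hω.1
  set q : E (k + l) → ℝ := fun x => topCoeff rfl (wedge (evalForm P x) (evalForm Q x)) with hq
  have hqc : Continuous q := continuous_topCoeff_wedge_evalForm P Q
  have hqsum : ∀ x, (∏ i, (vertexBasis T).coord i x) * q x =
      ∑ I : Fin k → Fin (k + l + 1), (∏ j, (vertexBasis T).coord (I j) x) *
        (evalForm P x fun j => vertexBasis T (I j) - x) ^ 2 := fun x => by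
    rw [hq, ← topCoeff_wedge_smul, hQω, topCoeff_wedge_dualAt]
  have hint : ∫ x in body T, e x * q x = 0 := hmoments _ hQ
  have hnonneg : 0 ≤ᵐ[volume.restrict (body T)] fun x => e x * q x := by
    filter_upwards [ae_restrict_body_mem_interior T] with x hx
    have hx' : ∀ i, 0 < (vertexBasis T).coord i x := by rwa [interior_body] at hx
    refine mul_nonneg (he_pos x (interior_subset hx)).le ?_
    refine nonneg_of_mul_nonneg_right (b := q x) ?_
      (Finset.prod_pos fun i _ => hx' i : 0 < ∏ i, (vertexBasis T).coord i x)
    rw [hqsum]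
    exact Finset.sum_nonneg fun I _ => sum_prod_coord_mul_sq_nonneg T hx' _ I
  have hae := (setIntegral_eq_zero_iff_of_nonneg_ae hnonneg
    (he_int.mul_continuousOn hqc.continuousOn (isCompact_body T))).1 hint
  -- Positivity of e gives q = 0 almost everywhere; continuity of q, not of e, makes this hold
  -- everywhere inside T.
  have hq0 : Set.EqOn q 0 (interior (body T)) := by
    refine Measure.eqOn_open_of_ae_eq (μ := volume) ?_ isOpen_interior hqc.continuousOn
      continuousOn_const
    filter_upwards [ae_restrict_of_ae_restrict_of_subset interior_subset hae,
      ae_restrict_mem isOpen_interior.measurableSet] with x hx hxT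
    exact (mul_eq_zero.1 hx).resolve_left (he_pos x (interior_subset hxT)).ne'
  have hP : P = 0 := by
    ext1 u
    refine eq_zero_of_evalAt_eq_zero_of_coord_pos T fun x hx => ?_
    have hx' : x ∈ interior (body T) := by rwa [interior_body]
    have h0 := hqsum x
    rw [hq0 hx', Pi.zero_apply, mul_zero, eq_comm,
      Finset.sum_eq_zero_iff_of_nonneg fun I _ => sum_prod_coord_mul_sq_nonneg T hx _ I] at h0
    have h1 : evalForm P x = 0 := alternating_eq_zero_of_vertices T fun I =>
      pow_eq_zero_iff two_ne_zero |>.1 <| (mul_eq_zero.1 (h0 I (Finset.mem_univ I))).resolve_left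
        (Finset.prod_pos fun _ _ => hx _).ne'
    rw [← evalForm_apply, h1, AlternatingMap.zero_apply]
  rw [hP]
  funext x
  ext u
  exact map_zero (evalAt x)

end QuasiForms

theorem mainTheorem4 (n k r : ℕ) (hk : k ≤ n) (hr : 1 ≤ r)
    (T : Affine.Simplex ℝ (QuasiForms.E n) n)
    (e : QuasiForms.E n → ℝ)
    (he_pos : ∀ x ∈ QuasiForms.body T, 0 < e x)
    (he_int : IntegrableOn e (QuasiForms.body T) volume)
    (ω : QuasiForms.Form n k)
    (hω : ω ∈ QuasiForms.PRingForm T (r : ℤ) k)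
    (hmoments : ∀ η ∈ QuasiForms.PMinusForm n ((r : ℤ) - (n : ℤ) + (k : ℤ)) (n - k),
      QuasiForms.integralForm (Nat.add_sub_of_le hk) T
        (fun x => e x • QuasiForms.wedge (ω x) (η x)) = 0) :
    ω = 0 := by
  -- Replacing n - k by a free l lets n be substituted by k + l, removing the cast in the top
  -- degree.
  have key : ∀ (l : ℕ) (h : k + l = n),
      (∀ η ∈ QuasiForms.PMinusForm n ((r : ℤ) - (n : ℤ) + (k : ℤ)) l,
        QuasiForms.integralForm h T (fun x => e x • QuasiForms.wedge (ω x) (η x)) = 0) →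
      ω = 0 := by
    rintro l rfl hη
    refine QuasiForms.eq_zero_of_forall_integralForm_eq_zero hr T he_pos he_int hω fun η h => ?_
    refine hη η ?_
    convert h using 2
    push_cast
    ring
  exact key (n - k) (Nat.add_sub_of_le hk) hmoments
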